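/- Consider the congested clique on $n$ nodes: the nodes $V=\{1,\dots,n\}$ know $n$ and their own identifiers, and computation proceeds in synchronous rounds; in each round every node $i$ sends to every node $k\in V$ (possibly different messages to different nodes) one message of at most $B$ bits, which is determined by $i$, $k$, the local input of $i$, and all messages that $i$ received in earlier rounds. Local computation is unrestricted and deterministic. In the Information Distribution Task with message size $M$, each node $i\in V$ is given $n$ messages $m_i^1,\dots,m_i^n$; the message $m_i^j$ consists of its source $i$, its destination $d(m_i^j)\in V$, its index $j$, and a content, which is a bit string of length at most $M$. Initially node $i$ knows only its own messages, including their destinations. The input is arbitrary subject to the condition that for every $k\in V$ the set $\mathcal R_k=\{m_i^j : i,j\in V,\ d(m_i^j)=k\}$ has exactly $n$ elements. An algorithm solves the task within $R$ rounds if for every such input each node $k$ can, after $R$ rounds, output $\mathcal R_k$ as a function of $k$, its local input and the messages it has received. **Theorem.** For every constant $c\in\mathbb N$ there is a constant $C\in\mathbb N$ such that for every $n$ (whether or not $n$ is a perfect square) and every message size $M\le c\lceil\log_2 n\rceil$ there is a deterministic algorithm on the congested clique of $n$ nodes, with messages of at most $C\lceil\log_2 n\rceil$ bits, that solves the Information Distribution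 Task with message size $M$ within $16$ rounds. -/

import Mathlib

namespace CongestedClique

/-- Bit strings of length at most `b`. -/
abbrev BitString (b : ℕ) : Type := {l : List Bool // l.length ≤ b}

/-- What a node has received so far: one entry per completed round, the most recent round first;
each entry gives, for every node `j`, the message that was received from `j` in that round. -/
abbrev History (n B : ℕ) : Type := List (Fin n → BitString B)

/-- A deterministic algorithm for the congested clique on the node set `Fin n`, with bandwidth `B`
(bits per round and directed edge), local inputs in `In` and local outputs in `Out`.
A node's behaviour is an arbitrary function of its own identifier, its own input and the messages
that it has received so far (the length of the history tells it the current round). Different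
messages may be sent to different nodes in the same round; nodes also send to themselves. -/
structure Algorithm (n B : ℕ) (In Out : Type) where
  /-- `send i x h k` is the message that node `i`, with input `x` and history `h`, sends to `k`. -/
  send : Fin n → In → History n B → Fin n → BitString B
  /-- `output i x h` is the output of node `i` with input `x` when it stops with history `h`. -/
  output : Fin n → In → History n B → Out

namespace Algorithm

variable {n B : ℕ} {In Out : Type}

/-- The history of each node after `t` synchronous rounds, when node `i` has input `x i`. -/
def history (A : Algorithm n B In Out) (x : Fin n → In) : ℕ → Fin n → History n B
  | 0, _ => []
  | t + 1, k => (fun i => A.send i (x i) (A.history x t i) k) :: A.history x t k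

/-- The output of node `k` after `R` rounds, when node `i` has input `x i`. -/
def result (A : Algorithm n B In Out) (R : ℕ) (x : Fin n → In) (k : Fin n) : Out :=
  A.output k (x k) (A.history x R k)

end Algorithm

/-- A message that has to be delivered. It carries its source `i`, its destination and its number
`j` among the messages of the source, besides a content of at most `M` bits. -/
@[ext] structure Message (n M : ℕ) where
  source : Fin n
  dest : Fin n
  index : Fin n
  content : BitString M

/-- The local input of a node: the destinations and contents of its `n` messages. -/
abbrev LocalInput (n M : ℕ) : Type := Fin n → Fin n × BitString M

variable {n M : ℕ}

/-- The `j`-th message of node `i`. -/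
def message (x : Fin n → LocalInput n M) (i j : Fin n) : Message n M :=
  ⟨i, (x i j).1, j, (x i j).2⟩

/-- The set `S_i` of the messages whose source is `i`. -/
def sourceSet (x : Fin n → LocalInput n M) (i : Fin n) : Set (Message n M) :=
  Set.range (message x i)

/-- The set `R_k` of the messages that node `k` shall receive. -/
def receiveSet (x : Fin n → LocalInput n M) (k : Fin n) : Set (Message n M) :=
  {m | m ∈ (⋃ i, sourceSet x i) ∧ m.dest = k}

/-- The inputs of the Information Distribution Task: every node is the destination of exactly
`n` messages (that it is the source of exactly `n` messages is built into `LocalInput`). -/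
def IsIDTInput (x : Fin n → LocalInput n M) : Prop :=
  ∀ k, (receiveSet x k).ncard = n

/-- The algorithm `A` solves the Information Distribution Task within `R` rounds: on every input,
after `R` rounds every node knows the set of the messages destined to it. -/
def SolvesIDT {B : ℕ} (A : Algorithm n B (LocalInput n M) (Set (Message n M))) (R : ℕ) : Prop :=
  ∀ x : Fin n → LocalInput n M, IsIDTInput x → ∀ k, A.result R x k = receiveSet x k

end CongestedClique

open Function

namespace CongestedClique

/-! Put s = ⌊√n⌋, so s² ≤ n ≤ 3s², and let the group of a node be its residue mod s; the quotient by
s, which is below 3s, locates it in its group. Nine rounds suffice: one spreads the messages, four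
bring each into the group of its destination, four deliver it within that group. For the spreading,
each source sorts its messages by destination group and sends the j-th to node j; then any group
holds at most 4n messages for any other (`card_sortedPosition_mod_le`). Both moves are instances of
`Knows.groupMove`. Within a group, messages are edges of a bipartite multigraph joining nodes to
message classes, of degree at most 4n. Two rounds make its edge multiplicities known to the whole
group (`Knows.share`), so all its nodes pick the same greedy colouring with 8n colours. A message
travels through the node given by its colour mod n; properness of the colouring leaves at most 8
messages per link in both hops. Algorithms are never written out: `Knows` records which quantities
are available after t rounds, and it is enough that inputs looking alike to a node give alike
messages. -/

/-- The admissible inputs of the Information Distribution Task. -/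
abbrev IDTInput (n M : ℕ) : Type := {x : Fin n → LocalInput n M // IsIDTInput x}

/-- After `t` rounds with bandwidth `B`, every node `k` can know `F x k` on every admissible input
`x`. -/
def Knows {n M : ℕ} {α : Type} (B t : ℕ) (F : IDTInput n M → Fin n → α) : Prop :=
  ∃ A : Algorithm n B (LocalInput n M) α, ∀ x k, A.result t x.1 k = F x k

/-- The values of type `β` can be encoded with at most `B` bits. -/
def Fits (B : ℕ) (β : Type) : Prop := ∃ f : β → BitString B, Injective f

/-! ### Knowledge after a number of rounds, and bandwidth -/

section Knowledge

variable {n M B t : ℕ} {α β γ : Type} {F : IDTInput n M → Fin n → α}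

theorem Algorithm.length_history {In Out : Type} (A : Algorithm n B In Out) (x : Fin n → In)
    (t : ℕ) (k : Fin n) : (A.history x t k).length = t := by
  induction t with
  | zero => rfl
  | succ t ih => simp [Algorithm.history, ih]

/-- One communication round: the messages depend on what their senders know, and the new knowledge
of a node on its old knowledge and on the messages that it receives. -/
theorem Knows.round (hF : Knows B t F) (hβ : Fits B β) [Nonempty β] [Nonempty γ]
    (msg : IDTInput n M → Fin n → Fin n → β)
    (hmsg : ∀ x y i, F x i = F y i → ∀ k, msg x i k = msg y i k)
    (G : IDTInput n M → Fin n → γ)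
    (hG : ∀ x y k, F x k = F y k → (∀ i, msg x i k = msg y i k) → G x k = G y k) :
    Knows B (t + 1) G := by
  classical
  obtain ⟨A, hA⟩ := hF
  obtain ⟨enc, henc⟩ := hβ
  -- Factoring through the local knowledge is what makes the messages computable by their senders;
  -- `extend` chooses arbitrary values for knowledge that no admissible input produces.
  have hm : ∀ i k, (fun x => msg x i k).FactorsThrough (fun x => F x i) :=
    fun i k x y h => hmsg x y i h k
  have hg : ∀ k, (fun x => G x k).FactorsThrough (fun x => (F x k, fun i => msg x i k)) := by
    intro k x y h
    obtain ⟨h₁, h₂⟩ := Prod.mk.inj h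
    exact hG x y k h₁ (fun i => congrFun h₂ i)
  let A' : Algorithm n B (LocalInput n M) γ :=
    { send := fun i a h k =>
        if h.length < t then A.send i a h k
        else enc (extend (fun x => F x i) (fun x => msg x i k)
          (fun _ => Classical.arbitrary β) (A.output i a h))
      output := fun k a h =>
        extend (fun x => (F x k, fun i => msg x i k)) (fun x => G x k)
          (fun _ => Classical.arbitrary γ)
          (A.output k a h.tail, fun i => invFun enc (h.headD (fun _ => ⟨[], by simp⟩) i)) }
  have hhist : ∀ x : Fin n → LocalInput n M, ∀ u ≤ t, ∀ k, A'.history x u k = A.history x u k := by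
    intro x u
    induction u with
    | zero => intros; rfl
    | succ u ih =>
      intro hu k
      have ih' := ih (by omega)
      simp only [Algorithm.history, ih']
      congr 1
      funext i
      simp only [A']
      rw [if_pos (by rw [Algorithm.length_history]; omega)]
  refine ⟨A', fun x k => ?_⟩
  have hres : ∀ i, A.output i (x.1 i) (A.history x.1 t i) = F x i := fun i => hA x i
  have hsend : ∀ i, A'.send i (x.1 i) (A.history x.1 t i) k = enc (msg x i k) := by
    intro i
    simp only [A']
    rw [if_neg (by rw [Algorithm.length_history]; omega), hres,
      (hm i k).extend_apply]
  have hdec : ∀ b, invFun enc (enc b) = b := leftInverse_invFun henc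
  simp only [Algorithm.result, Algorithm.history, hhist _ _ le_rfl, hsend]
  simp only [A', List.tail_cons, List.headD_cons, hres, hdec]
  exact (hg k).extend_apply _ x

theorem Knows.of_determined (hF : Knows B t F) [Nonempty γ] (G : IDTInput n M → Fin n → γ)
    (hG : ∀ x y k, F x k = F y k → G x k = G y k) : Knows B t G := by
  classical
  obtain ⟨A, hA⟩ := hF
  refine ⟨⟨A.send, fun k a h => extend (fun x => F x k) (fun x => G x k)
    (fun _ => Classical.arbitrary γ) (A.output k a h)⟩, fun x k => ?_⟩
  have hhist : ∀ u k, Algorithm.history (⟨A.send, fun k a h => extend (fun x => F x k)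
      (fun x => G x k) (fun _ => Classical.arbitrary γ) (A.output k a h)⟩ :
        Algorithm n B (LocalInput n M) γ) x.1 u k = A.history x.1 u k := by
    intro u
    induction u with
    | zero => intros; rfl
    | succ u ih => intro k; simp only [Algorithm.history, ih]
  have hres : A.output k (x.1 k) (A.history x.1 t k) = F x k := hA x k
  simp only [Algorithm.result, hhist, hres]
  exact Function.FactorsThrough.extend_apply (f := fun x => F x k) (g := fun x => G x k)
    (fun x y h => hG x y k h) _ x

theorem fits_unit : Fits B Unit := ⟨fun _ => ⟨[], by simp⟩, fun _ _ _ => rfl⟩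

theorem Knows.mono [Nonempty α] (hF : Knows B t F) {u : ℕ} (h : t ≤ u) : Knows B u F := by
  induction u, h using Nat.le_induction with
  | base => exact hF
  | succ u _ ih =>
    exact ih.round fits_unit (fun _ _ _ => ()) (fun _ _ _ _ _ => rfl) F (fun _ _ _ h _ => h)

theorem fits_of_card_le [Finite β] (h : Nat.card β ≤ 2 ^ B) : Fits B β := by
  have : Fintype β := Fintype.ofFinite β
  have h' : Fintype.card β ≤ Fintype.card (Fin B → Bool) := by
    simpa [Nat.card_eq_fintype_card] using h
  obtain ⟨f⟩ := Function.Embedding.nonempty_of_card_le h'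
  refine ⟨fun b => ⟨List.ofFn (f b), by simp⟩, fun a b hab => f.injective ?_⟩
  exact List.ofFn_injective (Subtype.mk.inj hab)

/-- Padding with `none` turns a string into a word of exactly b symbols from a three-letter
alphabet, hence the crude count 3^b ≤ 2^(2b) below. -/
theorem injective_getElem?_bitString (b : ℕ) :
    Injective (fun (l : BitString b) (i : Fin b) => l.1[(i : ℕ)]?) := by
  intro l l' h
  apply Subtype.ext
  apply List.ext_getElem?
  intro i
  by_cases hi : i < b
  · exact congrFun h ⟨i, hi⟩
  · rw [List.getElem?_eq_none (by have := l.2; omega), List.getElem?_eq_none (by have := l'.2; omega)]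

instance (b : ℕ) : Finite (BitString b) := Finite.of_injective _ (injective_getElem?_bitString b)

theorem card_bitString_le (b : ℕ) : Nat.card (BitString b) ≤ 2 ^ (2 * b) := by
  refine (Nat.card_le_card_of_injective _ (injective_getElem?_bitString b)).trans ?_
  simp only [Nat.card_eq_fintype_card, Fintype.card_pi, Fintype.card_option, Fintype.card_bool,
    Finset.prod_const, Finset.card_univ, Fintype.card_fin]
  rw [pow_mul]
  exact Nat.pow_le_pow_left (by norm_num) b

end Knowledge

/-! ### Moving stored messages over links of bounded load -/

section Transfer

variable {n M B t : ℕ} {α γ : Type} {F : IDTInput n M → Fin n → α}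

/-- The destination and the content of the message with source `e.1` and index `e.2`. -/
def payload (x : IDTInput n M) (e : Fin n × Fin n) : Fin n × BitString M := x.1 e.1 e.2

/-- The messages stored at node `k`, when message `e` is stored at node `loc e`. -/
def held (x : IDTInput n M) (loc : Fin n × Fin n → Fin n) (k : Fin n) :
    Set ((Fin n × Fin n) × (Fin n × BitString M)) :=
  {z | loc z.1 = k ∧ payload x z.1 = z.2}

/-- The messages that move from node `i` to node `k`, when message `e` moves from node `loc e` to
node `loc' e`. -/
def sent (x : IDTInput n M) (loc loc' : Fin n × Fin n → Fin n) (i k : Fin n) :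
    Set ((Fin n × Fin n) × (Fin n × BitString M)) :=
  {z | loc z.1 = i ∧ loc' z.1 = k ∧ payload x z.1 = z.2}

/-- The held set lists identities together with payloads, so inputs that look alike at k agree on
every message stored there. -/
theorem loc_eq_of_held_eq {x y : IDTInput n M} {loc loc' : Fin n × Fin n → Fin n} {k : Fin n}
    (h : held x loc k = held y loc' k) {e : Fin n × Fin n} (he : loc e = k) :
    loc' e = k ∧ payload y e = payload x e := by
  have : (e, payload x e) ∈ held x loc k := ⟨he, rfl⟩
  rw [h] at this
  exact this

theorem loc_iff_of_held_eq {x y : IDTInput n M} {loc loc' : Fin n × Fin n → Fin n} {k : Fin n}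
    (h : held x loc k = held y loc' k) (e : Fin n × Fin n) : loc e = k ↔ loc' e = k :=
  ⟨fun he => (loc_eq_of_held_eq h he).1, fun he => (loc_eq_of_held_eq h.symm he).1⟩

theorem held_eq_iUnion_sent (x : IDTInput n M) (loc loc' : Fin n × Fin n → Fin n) (k : Fin n) :
    held x loc' k = ⋃ i, sent x loc loc' i k := by
  ext z
  simp [held, sent]

theorem exists_slots {δ : Type} {a : ℕ} (s : Finset δ) (hs : s.card ≤ a) :
    ∃ f : Fin a → Option δ, ∀ z, z ∈ s ↔ ∃ i, f i = some z := by
  refine ⟨fun i => s.toList[(i : ℕ)]?, fun z => ?_⟩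
  rw [← Finset.mem_toList, List.mem_iff_getElem?]
  constructor
  · rintro ⟨i, hi⟩
    have : i < s.toList.length := (List.getElem?_eq_some_iff.1 hi).1
    exact ⟨⟨i, by rw [Finset.length_toList] at this; omega⟩, hi⟩
  · rintro ⟨i, hi⟩
    exact ⟨i, hi⟩

/-- One round in which every node forwards the messages stored at it, at most `a` of them over each
edge. -/
theorem Knows.transfer (hF : Knows B t F) {a : ℕ}
    (ha : Fits B (Fin a → Option ((Fin n × Fin n) × (Fin n × BitString M)))) [Nonempty γ]
    (loc loc' : IDTInput n M → Fin n × Fin n → Fin n)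
    (hheld : ∀ x y i, F x i = F y i → held x (loc x) i = held y (loc y) i)
    (hnext : ∀ x y i, F x i = F y i → ∀ e, loc x e = i → loc' x e = loc' y e)
    (hload : ∀ x i k, (Finset.univ.filter fun e => loc x e = i ∧ loc' x e = k).card ≤ a)
    (G : IDTInput n M → Fin n → γ)
    (hG : ∀ x y k, F x k = F y k →
      (∀ i, sent x (loc x) (loc' x) i k = sent y (loc y) (loc' y) i k) → G x k = G y k) :
    Knows B (t + 1) G := by
  classical
  have hslots : ∀ S : Set ((Fin n × Fin n) × (Fin n × BitString M)), S.ncard ≤ a →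
      ∃ f : Fin a → Option ((Fin n × Fin n) × (Fin n × BitString M)),
        ∀ z, z ∈ S ↔ ∃ i, f i = some z := by
    intro S hS
    obtain ⟨f, hf⟩ := exists_slots (a := a) S.toFinite.toFinset
      (by rwa [← Set.ncard_eq_toFinset_card S])
    exact ⟨f, fun z => by rw [← hf, Set.Finite.mem_toFinset]⟩
  choose! enc henc using hslots
  have hcard : ∀ x i k, (sent x (loc x) (loc' x) i k).ncard ≤ a := by
    intro x i k
    refine le_trans ?_ (hload x i k)
    rw [← Set.ncard_coe_finset]
    refine Set.ncard_le_ncard_of_injOn Prod.fst ?_ ?_ (Set.toFinite _)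
    · rintro z ⟨h₁, h₂, -⟩
      simp [h₁, h₂]
    · rintro ⟨e, p⟩ ⟨-, -, h₁⟩ ⟨e', p'⟩ ⟨-, -, h₂⟩ h
      simp only at h h₁ h₂
      subst h
      rw [← h₁, ← h₂]
  have hsent : ∀ x y i, F x i = F y i → ∀ k,
      sent x (loc x) (loc' x) i k ⊆ sent y (loc y) (loc' y) i k := by
    rintro x y i h k ⟨e, p⟩ ⟨h₁, h₂, h₃⟩
    obtain ⟨h₄, h₅⟩ := loc_eq_of_held_eq (hheld x y i h) h₁
    exact ⟨h₄, (hnext x y i h e h₁).symm.trans h₂, h₅.trans h₃⟩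
  refine hF.round ha (fun x i k => enc (sent x (loc x) (loc' x) i k)) ?_ G ?_
  · intro x y i h k
    exact congrArg enc ((hsent x y i h k).antisymm (hsent y x i h.symm k))
  · intro x y k h hm
    refine hG x y k h fun i => Set.ext fun z => ?_
    rw [henc _ (hcard x i k), henc _ (hcard y i k), hm i]

end Transfer

/-! ### Edge colouring -/

/-- Greedy edge colouring of a bipartite multigraph of maximal degree `D` with `2 * D` colours. -/
theorem exists_edge_coloring {ε ι κ : Type} [DecidableEq ε] [DecidableEq ι] [DecidableEq κ]
    (f : ε → ι) (g : ε → κ) (D : ℕ) (T : Finset ε)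
    (hf : ∀ i, (T.filter fun e => f e = i).card ≤ D)
    (hg : ∀ i, (T.filter fun e => g e = i).card ≤ D) :
    ∃ col : ε → ℕ, (∀ e ∈ T, col e < 2 * D) ∧
      ∀ e ∈ T, ∀ e' ∈ T, f e = f e' ∨ g e = g e' → col e = col e' → e = e' := by
  induction T using Finset.induction_on with
  | empty => exact ⟨fun _ => 0, by simp, by simp⟩
  | insert a T ha ih =>
    obtain ⟨col, hcol, hinj⟩ := ih
      (fun i => (Finset.card_le_card (Finset.filter_subset_filter _ (Finset.subset_insert a T))).trans
        (hf i))
      (fun i => (Finset.card_le_card (Finset.filter_subset_filter _ (Finset.subset_insert a T))).trans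
        (hg i))
    have h₁ : (T.filter fun e => f e = f a).card + 1 ≤ D := by
      have := hf (f a)
      rwa [Finset.filter_insert, if_pos rfl, Finset.card_insert_of_notMem (by simp [ha])] at this
    have h₂ : (T.filter fun e => g e = g a).card + 1 ≤ D := by
      have := hg (g a)
      rwa [Finset.filter_insert, if_pos rfl, Finset.card_insert_of_notMem (by simp [ha])] at this
    -- At each end of the new edge at most D - 1 edges are already coloured, so at most 2D - 2
    -- colours are forbidden.
    obtain ⟨b, hb, hb'⟩ : ∃ b ∈ Finset.range (2 * D),
        b ∉ ((T.filter fun e => f e = f a) ∪ (T.filter fun e => g e = g a)).image col := by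
      apply Finset.exists_mem_notMem_of_card_lt_card
      have h₃ := Finset.card_image_le (s := (T.filter fun e => f e = f a) ∪
        (T.filter fun e => g e = g a)) (f := col)
      have h₄ := Finset.card_union_le (T.filter fun e => f e = f a) (T.filter fun e => g e = g a)
      rw [Finset.card_range]
      omega
    have hne : ∀ e ∈ T, f e = f a ∨ g e = g a → col e ≠ b := by
      rintro e he h rfl
      exact hb' (Finset.mem_image_of_mem _ (by simpa [he] using h))
    refine ⟨update col a b, ?_, ?_⟩
    · intro e he
      by_cases h : e = a
      · subst h; simpa using hb
      · rw [update_of_ne h]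
        exact hcol e (by simpa [h] using he)
    · intro e he e' he' h heq
      by_cases h1 : e = a <;> by_cases h2 : e' = a
      · rw [h1, h2]
      · subst h1
        rw [update_self, update_of_ne h2] at heq
        exact absurd heq.symm (hne e' (by simpa [h2] using he')
          (h.imp Eq.symm Eq.symm))
      · subst h2
        rw [update_self, update_of_ne h1] at heq
        exact absurd heq (hne e (by simpa [h1] using he) h)
      · rw [update_of_ne h1, update_of_ne h2] at heq
        exact hinj e (by simpa [h1] using he) e' (by simpa [h2] using he') h heq

section Rank

variable {ε : Type}

open Classical in
/-- The number of an element of a finite set in some enumeration of the set. -/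
noncomputable def rank (T : Finset ε) (e : ε) : ℕ :=
  if h : e ∈ T then T.equivFin ⟨e, h⟩ else 0

theorem rank_lt {T : Finset ε} {e : ε} (he : e ∈ T) : rank T e < T.card := by
  rw [rank, dif_pos he]
  exact Fin.is_lt _

theorem rank_injOn {T : Finset ε} {e e' : ε} (he : e ∈ T) (he' : e' ∈ T)
    (h : rank T e = rank T e') : e = e' := by
  rw [rank, dif_pos he, rank, dif_pos he'] at h
  exact congrArg Subtype.val (T.equivFin.injective (Fin.ext h))

theorem exists_rank_eq {T : Finset ε} {r : ℕ} (hr : r < T.card) : ∃ e ∈ T, rank T e = r := by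
  refine ⟨(T.equivFin.symm ⟨r, hr⟩).1, (T.equivFin.symm ⟨r, hr⟩).2, ?_⟩
  rw [rank, dif_pos (T.equivFin.symm ⟨r, hr⟩).2]
  simp

end Rank

/-! ### A colouring that a whole group computes from its multiplicities -/

section Coloring

/-- A proper colouring with `2 * D` colours of the edges of the bipartite multigraph in which `i`
and `q` are joined by `c i q` edges. -/
structure IsColoring (D : ℕ) (c : ℕ → ℕ → ℕ) (col : ℕ → ℕ → ℕ → ℕ) : Prop where
  lt : ∀ {i q r}, r < c i q → col i q r < 2 * D
  inj : ∀ {i q r i' q' r'}, r < c i q → r' < c i' q' → i = i' ∨ q = q' →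
    col i q r = col i' q' r' → i = i' ∧ q = q' ∧ r = r'

open Classical in
/-- A proper colouring, if there is one. -/
noncomputable def coloring (D : ℕ) (c : ℕ → ℕ → ℕ) : ℕ → ℕ → ℕ → ℕ :=
  if h : ∃ col, IsColoring D c col then h.choose else fun _ _ _ => 0

theorem isColoring_coloring {D : ℕ} {c : ℕ → ℕ → ℕ} (h : ∃ col, IsColoring D c col) :
    IsColoring D c (coloring D c) := by
  rw [coloring, dif_pos h]
  exact h.choose_spec

variable {n : ℕ} (s D : ℕ) (loc : Fin n × Fin n → Fin n) (cl : Fin n × Fin n → ℕ)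

/-- The messages of class `q` stored at node `i`. -/
def classSet (i q : ℕ) : Finset (Fin n × Fin n) :=
  Finset.univ.filter fun e => (loc e : ℕ) = i ∧ cl e = q

/-- The number of messages of class `q` stored at node `i`, for the nodes `i` of group `w`. -/
def groupCount (w : ℕ) : ℕ → ℕ → ℕ := fun i q =>
  if i % s = w then (classSet loc cl i q).card else 0

theorem mem_classSet_self (e : Fin n × Fin n) : e ∈ classSet loc cl (loc e) (cl e) := by
  simp [classSet]

/-- The group's messages are replaced by triples (node, class, rank). Parallel edges then differ
only by rank, so the colouring depends on the multiplicities alone and not on which messages are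
present. -/
theorem exists_isColoring (w : ℕ)
    (hrow : ∀ i, (Finset.univ.filter fun e => loc e = i).card ≤ D)
    (hcol : ∀ q, (Finset.univ.filter fun e => (loc e : ℕ) % s = w ∧ cl e = q).card ≤ D) :
    ∃ col, IsColoring D (groupCount s loc cl w) col := by
  classical
  let h : Fin n × Fin n → ℕ × ℕ × ℕ := fun e =>
    (loc e, cl e, rank (classSet loc cl (loc e) (cl e)) e)
  let T := (Finset.univ.filter fun e => (loc e : ℕ) % s = w).image h
  have hT : ∀ {i q r}, r < groupCount s loc cl w i q → (i, q, r) ∈ T := by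
    intro i q r hr
    rw [groupCount] at hr
    split_ifs at hr with hw
    · obtain ⟨e, he, rfl⟩ := exists_rank_eq hr
      obtain ⟨rfl, rfl⟩ : (loc e : ℕ) = i ∧ cl e = q := by simpa [classSet] using he
      exact Finset.mem_image.2 ⟨e, by simpa using hw, rfl⟩
    · omega
  obtain ⟨col, h₁, h₂⟩ := exists_edge_coloring (fun z : ℕ × ℕ × ℕ => z.1) (fun z => z.2.1) D T
    (by
      intro i
      by_cases hi : i < n
      · refine le_trans (le_trans (Finset.card_le_card (t :=
          (Finset.univ.filter fun e => loc e = ⟨i, hi⟩).image h) ?_) Finset.card_image_le)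
          (hrow ⟨i, hi⟩)
        intro z hz
        obtain ⟨hz, hzi⟩ := Finset.mem_filter.1 hz
        obtain ⟨e, -, rfl⟩ := Finset.mem_image.1 hz
        exact Finset.mem_image_of_mem _ (by simpa [Fin.ext_iff] using hzi)
      · rw [Finset.filter_false_of_mem, Finset.card_empty]
        · exact Nat.zero_le _
        · intro z hz
          obtain ⟨e, -, rfl⟩ := Finset.mem_image.1 hz
          have := (loc e).2
          simp only [h]
          omega)
    (by
      intro q
      refine le_trans (le_trans (Finset.card_le_card (t :=
        (Finset.univ.filter fun e => (loc e : ℕ) % s = w ∧ cl e = q).image h) ?_)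
        Finset.card_image_le) (hcol q)
      intro z hz
      obtain ⟨hz, hzi⟩ := Finset.mem_filter.1 hz
      obtain ⟨e, he, rfl⟩ := Finset.mem_image.1 hz
      exact Finset.mem_image_of_mem _ (by simpa using ⟨(Finset.mem_filter.1 he).2, hzi⟩))
  refine ⟨fun i q r => col (i, q, r), fun hr => h₁ _ (hT hr), fun hr hr' hor heq => ?_⟩
  simpa using h₂ _ (hT hr) _ (hT hr') hor heq

/-- The colour of message `e` in the colouring of the messages of its group. -/
noncomputable def color (e : Fin n × Fin n) : ℕ :=
  coloring D (groupCount s loc cl (loc e % s)) (loc e) (cl e)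
    (rank (classSet loc cl (loc e) (cl e)) e)

variable {s D loc cl}

theorem rank_lt_groupCount (e : Fin n × Fin n) :
    rank (classSet loc cl (loc e) (cl e)) e < groupCount s loc cl (loc e % s) (loc e) (cl e) := by
  rw [groupCount, if_pos rfl]
  exact rank_lt (mem_classSet_self loc cl e)

theorem color_lt (hrow : ∀ i, (Finset.univ.filter fun e => loc e = i).card ≤ D)
    (hcol : ∀ w q, (Finset.univ.filter fun e => (loc e : ℕ) % s = w ∧ cl e = q).card ≤ D)
    (e : Fin n × Fin n) : color s D loc cl e < 2 * D :=
  (isColoring_coloring (exists_isColoring s D loc cl _ hrow (hcol _))).lt (rank_lt_groupCount e)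

theorem color_inj (hrow : ∀ i, (Finset.univ.filter fun e => loc e = i).card ≤ D)
    (hcol : ∀ w q, (Finset.univ.filter fun e => (loc e : ℕ) % s = w ∧ cl e = q).card ≤ D)
    {e e' : Fin n × Fin n} (hw : (loc e : ℕ) % s = loc e' % s) (hor : loc e = loc e' ∨ cl e = cl e')
    (h : color s D loc cl e = color s D loc cl e') : e = e' := by
  have hc := isColoring_coloring (exists_isColoring s D loc cl (loc e % s) hrow (hcol _))
  have h' := rank_lt_groupCount (s := s) (loc := loc) (cl := cl) e'
  rw [color, color, ← hw] at h
  rw [← hw] at h'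
  obtain ⟨h₁, h₂, h₃⟩ := hc.inj (rank_lt_groupCount e) h' (hor.imp (congrArg _) id) h
  have he := mem_classSet_self loc cl e
  have he' := mem_classSet_self loc cl e'
  rw [← h₁, ← h₂] at he' h₃
  exact rank_injOn he he' h₃

/-- With the residue mod n fixed, the quotient by n determines the value and takes at most a values.
This turns 8n colours into 8 messages per link. -/
theorem card_le_of_mod_eq {ε : Type} {a v : ℕ} (hn : 0 < n) (S : Finset ε) (f : ε → ℕ)
    (hlt : ∀ e ∈ S, f e < a * n) (hmod : ∀ e ∈ S, f e % n = v)
    (hinj : ∀ e ∈ S, ∀ e' ∈ S, f e = f e' → e = e') : S.card ≤ a := by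
  rw [← Finset.card_range a]
  refine Finset.card_le_card_of_injOn (fun e => f e / n) ?_ ?_
  · intro e he
    simpa using (Nat.div_lt_iff_lt_mul hn).2 (hlt e he)
  · intro e he e' he' h
    refine hinj e he e' he' ?_
    rw [← Nat.div_add_mod (f e) n, ← Nat.div_add_mod (f e') n, hmod e he, hmod e' he']
    simp only at h
    rw [h]

end Coloring

/-! ### Rerouting within all groups simultaneously -/

section GroupMove

variable {n M B t s : ℕ}

/-- Within each group, the numbers of messages of the different classes at the nodes of the group
become known to all nodes of the group in two rounds. -/
theorem Knows.share (hs : 0 < s) (hsn : s * s ≤ n) (hns : n ≤ 3 * s * s)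
    {loc : IDTInput n M → Fin n × Fin n → Fin n} (cls : Fin n → ℕ) (hcls : ∀ d, cls d < 3 * s)
    (hB : Fits B (Fin 3 → Fin 3 → Fin (4 * n + 1)))
    (hK : Knows B t fun x => held x (loc x))
    (hrow : ∀ x i, (Finset.univ.filter fun e => loc x e = i).card ≤ 4 * n) :
    Knows B (t + 2) fun x k => (held x (loc x) k,
      groupCount s (loc x) (fun e => cls (payload x e).1) (k % s)) := by
  set cnt : IDTInput n M → ℕ → ℕ → ℕ := fun x i q =>
    (classSet (loc x) (fun e => cls (payload x e).1) i q).card with hcnt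
  have hout : ∀ x i q, ¬ i < n → cnt x i q = 0 := by
    intro x i q hi
    simp only [hcnt, classSet, Finset.card_eq_zero]
    refine Finset.filter_false_of_mem fun e _ he => ?_
    have := (loc x e).2
    omega
  have hle : ∀ x i q, cnt x i q < 4 * n + 1 := by
    intro x i q
    by_cases hi : i < n
    · refine Nat.lt_succ_of_le (le_trans (Finset.card_le_card ?_) (hrow x ⟨i, hi⟩))
      intro e he
      have := (Finset.mem_filter.1 he).2.1
      simpa [Fin.ext_iff] using this
    · rw [hout x i q hi]
      exact Nat.succ_pos _
  have hcl : ∀ x i q, ¬ q < 3 * s → cnt x i q = 0 := by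
    intro x i q hq
    simp only [hcnt, classSet, Finset.card_eq_zero]
    refine Finset.filter_false_of_mem fun e _ he => ?_
    have := hcls (payload x e).1
    omega
  have hloc : ∀ x y (i : Fin n) q, held x (loc x) i = held y (loc y) i → cnt x i q = cnt y i q := by
    intro x y i q h
    simp only [hcnt, classSet]
    congr 1
    ext e
    simp only [Finset.mem_filter, Finset.mem_univ, true_and, ← Fin.ext_iff]
    constructor
    · rintro ⟨h₁, h₂⟩
      obtain ⟨h₃, h₄⟩ := loc_eq_of_held_eq h h₁
      exact ⟨h₃, by rw [h₄, h₂]⟩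
    · rintro ⟨h₁, h₂⟩
      obtain ⟨h₃, h₄⟩ := loc_eq_of_held_eq h.symm h₁
      exact ⟨h₃, by rw [h₄, h₂]⟩
  have hK₁ : Knows B (t + 1) fun x (v : Fin n) => (held x (loc x) v,
      fun (i : Fin n) (b : Fin 3) => cnt x i (v % s + b * s)) := by
    -- Node v collects the counts of the classes congruent to v mod s. The ignored argument gives
    -- both rounds the same message type.
    refine hK.round hB (fun x i v _ b => ⟨cnt x i (v % s + b * s), hle _ _ _⟩) ?_ _ ?_
    · intro x y i h k
      funext _ b
      exact Fin.ext (hloc x y i _ h)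
    · intro x y k h hm
      refine Prod.ext h ?_
      funext i b
      exact congrArg Fin.val (congrFun (congrFun (hm i) 0) b)
  -- Relay v reports to k only on those nodes of the group of k whose quotient by s is v / s + a *
  -- s, and only on the classes it collected: nine counts in all.
  refine hK₁.round hB (fun x v k a b =>
    ⟨cnt x (k % s + (v / s + a * s) * s) (v % s + b * s), hle _ _ _⟩) ?_ _ ?_
  · intro x y v h k
    funext a b
    apply Fin.ext
    by_cases hi : (k : ℕ) % s + (v / s + a * s) * s < n
    · exact congrFun (congrFun (Prod.mk.inj h).2 ⟨_, hi⟩) b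
    · exact (hout _ _ _ hi).trans (hout _ _ _ hi).symm
  · intro x y k h hm
    refine Prod.ext (Prod.mk.inj h).1 ?_
    funext i q
    change (if i % s = k % s then cnt x i q else 0) = (if i % s = k % s then cnt y i q else 0)
    split_ifs with hik
    · by_cases hi : i < n
      · by_cases hq : q < 3 * s
        -- This is the relay for the pair (i, q): its residue selects q mod s and its quotient
        -- selects i / s mod s. It is below s², so it exists.
        · have hv : q % s + (i / s % s) * s < n := by
            have h₁ := Nat.mod_lt q hs
            have h₂ := Nat.mod_lt (i / s) hs
            nlinarith
          have ha : i / s / s < 3 := by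
            rw [Nat.div_div_eq_div_mul, Nat.div_lt_iff_lt_mul (by positivity)]
            nlinarith
          have hb : q / s < 3 := by
            rw [Nat.div_lt_iff_lt_mul hs]
            exact hq
          have := congrArg Fin.val (congrFun (congrFun (hm ⟨_, hv⟩) ⟨_, ha⟩) ⟨_, hb⟩)
          have e₁ : (q % s + (i / s % s) * s) / s = i / s % s := by
            rw [Nat.add_mul_div_right _ _ hs, Nat.div_eq_of_lt (Nat.mod_lt q hs), zero_add]
          have e₂ : (q % s + (i / s % s) * s) % s = q % s := by
            rw [Nat.add_mul_mod_self_right, Nat.mod_mod]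
          have e₃ : i / s % s + i / s / s * s = i / s := by
            rw [mul_comm]; exact Nat.mod_add_div _ _
          have e₄ : (k : ℕ) % s + i / s * s = i := by
            rw [← hik, mul_comm]; exact Nat.mod_add_div _ _
          have e₅ : q % s + q / s * s = q := by
            rw [mul_comm]; exact Nat.mod_add_div _ _
          simpa only [e₁, e₂, e₃, e₄, e₅] using this
        · exact (hcl _ _ _ hq).trans (hcl _ _ _ hq).symm
      · exact (hout _ _ _ hi).trans (hout _ _ _ hi).symm
    · rfl

/-- In four rounds, every message is moved to a node that depends on its destination and the group
of the node where it is stored, provided that no node and no class within a group has more than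
`4 * n` messages and that the new node determines the group and the class. -/
theorem Knows.groupMove (hs : 0 < s) (hsn : s * s ≤ n) (hns : n ≤ 3 * s * s)
    {loc loc' : IDTInput n M → Fin n × Fin n → Fin n} (cls : Fin n → ℕ)
    (hcls : ∀ d, cls d < 3 * s)
    (hB : Fits B (Fin 3 → Fin 3 → Fin (4 * n + 1)))
    (hB' : Fits B (Fin 8 → Option ((Fin n × Fin n) × (Fin n × BitString M))))
    (hK : Knows B t fun x => held x (loc x))
    (hrow : ∀ x i, (Finset.univ.filter fun e => loc x e = i).card ≤ 4 * n)
    (hcol : ∀ x w q, (Finset.univ.filter fun e =>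
      (loc x e : ℕ) % s = w ∧ cls (payload x e).1 = q).card ≤ 4 * n)
    (hloc' : ∀ x y e, loc x e = loc y e → payload x e = payload y e → loc' x e = loc' y e)
    (hinj : ∀ x e e', loc' x e = loc' x e' →
      (loc x e : ℕ) % s = loc x e' % s ∧ cls (payload x e).1 = cls (payload x e').1) :
    Knows B (t + 4) fun x => held x (loc' x) := by
  have hn : 0 < n := lt_of_lt_of_le (Nat.mul_pos hs hs) hsn
  set cl : IDTInput n M → Fin n × Fin n → ℕ := fun x e => cls (payload x e).1 with hcl
  let mid : IDTInput n M → Fin n × Fin n → Fin n := fun x e =>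
    ⟨color s (4 * n) (loc x) (cl x) e % n, Nat.mod_lt _ hn⟩
  have hlt : ∀ x e, color s (4 * n) (loc x) (cl x) e < 8 * n := by
    intro x e
    have : color s (4 * n) (loc x) (cl x) e < 2 * (4 * n) := color_lt (hrow x) (hcol x) e
    omega
  have hK₂ := Knows.share hs hsn hns cls hcls hB hK hrow
  have hK₃ : Knows B (t + 3) fun x v i => sent x (loc x) (mid x) i v := by
    refine hK₂.transfer hB' loc mid (fun x y i h => (Prod.mk.inj h).1) ?_ ?_ _ ?_
    · intro x y i h e he
      obtain ⟨h₁, h₂⟩ := Prod.mk.inj h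
      obtain ⟨h₃, h₄⟩ := loc_eq_of_held_eq h₁ he
      have h₅ : cl y e = cl x e := by simp only [hcl, h₄]
      -- The rank comes from the local messages and the colouring from the shared counts, so the
      -- holder can compute the colour.
      have h₆ : classSet (loc x) (cl x) i (cl x e) = classSet (loc y) (cl y) i (cl x e) := by
        ext e'
        simp only [classSet, Finset.mem_filter, Finset.mem_univ, true_and, ← Fin.ext_iff]
        rw [loc_iff_of_held_eq h₁ e']
        refine and_congr_right fun h₇ => ?_
        simp only [hcl, (loc_eq_of_held_eq h₁.symm h₇).2]
      apply Fin.ext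
      simp only [mid, color, he, h₃, h₅, h₆]
      rw [h₂]
    -- First hop: messages leaving the same node have different colours.
    · intro x i k
      refine card_le_of_mod_eq hn _ (color s (4 * n) (loc x) (cl x)) (fun e _ => hlt x e)
        (v := k) ?_ ?_
      · intro e he
        exact congrArg Fin.val (Finset.mem_filter.1 he).2.2
      · intro e he e' he' h
        have h₁ := (Finset.mem_filter.1 he).2.1
        have h₂ := (Finset.mem_filter.1 he').2.1
        exact color_inj (hrow x) (hcol x) (by rw [h₁, h₂]) (Or.inl (by rw [h₁, h₂])) h
    · intro x y k _ h
      exact funext h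
  refine hK₃.transfer hB' mid loc' ?_ ?_ ?_ _ ?_
  · intro x y i h
    rw [held_eq_iUnion_sent x (loc x), held_eq_iUnion_sent y (loc y)]
    exact congrArg _ h
  · intro x y i h e he
    have h₁ : (e, payload x e) ∈ sent x (loc x) (mid x) (loc x e) i := ⟨rfl, he, rfl⟩
    rw [congrFun h (loc x e)] at h₁
    exact hloc' x y e h₁.1.symm h₁.2.2.symm
  -- Second hop: a common target forces a common group and class, hence different colours. Groups
  -- share the relays but do not collide here.
  · intro x i k
    refine card_le_of_mod_eq hn _ (color s (4 * n) (loc x) (cl x)) (fun e _ => hlt x e)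
      (v := i) ?_ ?_
    · intro e he
      exact congrArg Fin.val (Finset.mem_filter.1 he).2.1
    · intro e he e' he' h
      have h₁ := (Finset.mem_filter.1 he).2.2
      have h₂ := (Finset.mem_filter.1 he').2.2
      obtain ⟨h₃, h₄⟩ := hinj x e e' (h₁.trans h₂.symm)
      exact color_inj (hrow x) (hcol x) h₃ (Or.inr h₄) h
  · intro x y k _ h
    rw [held_eq_iUnion_sent x (mid x), held_eq_iUnion_sent y (mid y)]
    exact Set.iUnion_congr h

end GroupMove

/-! ### Sorting spreads each destination group evenly -/

section Counting

variable {n M s : ℕ}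

/-- The positions of an interval are spread evenly over the residue classes modulo `s`. -/
theorem mul_card_residue_le (g : Fin n → ℕ) (hg : Monotone g) (w q : ℕ) :
    s * (Finset.univ.filter fun j : Fin n => (j : ℕ) % s = w ∧ g j = q).card ≤
      (Finset.univ.filter fun j => g j = q).card + s := by
  set A := Finset.univ.filter fun j : Fin n => (j : ℕ) % s = w ∧ g j = q with hA
  rcases A.eq_empty_or_nonempty with h | h
  · simp [h]
  have hmem : ∀ j ∈ A, (j : ℕ) % s = w ∧ g j = q := fun j hj => (Finset.mem_filter.1 hj).2
  let m := A.max' h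
  have hm : m ∈ A := A.max'_mem h
  -- Each element j of A other than the maximum m opens a block j, …, j + s - 1 below m. By
  -- monotonicity g equals q on the block, and blocks are disjoint since their starts are congruent
  -- mod s.
  have key : ((A.erase m) ×ˢ Finset.range s).card ≤
      ((Finset.univ.filter fun j => g j = q).image Fin.val).card := by
    refine Finset.card_le_card_of_injOn (fun z => (z.1 : ℕ) + z.2) ?_ ?_
    · rintro ⟨j, r⟩ hz
      obtain ⟨hj, hr⟩ := Finset.mem_product.1 hz
      obtain ⟨hjm, hj⟩ := Finset.mem_erase.1 hj
      have hr : r < s := Finset.mem_range.1 hr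
      have hlt : (j : ℕ) < m := lt_of_le_of_ne (A.le_max' j hj) (fun h => hjm (Fin.ext h))
      have hle : (j : ℕ) + s ≤ m := by
        have hmod : (j : ℕ) ≡ m [MOD s] := (hmem j hj).1.trans (hmem m hm).1.symm
        have := Nat.le_of_dvd (by omega) ((Nat.modEq_iff_dvd' hlt.le).1 hmod)
        omega
      have hn : (j : ℕ) + r < n := by have := m.2; omega
      refine Finset.mem_coe.2 (Finset.mem_image.2 ⟨⟨j + r, hn⟩, ?_, rfl⟩)
      simp only [Finset.mem_filter, Finset.mem_univ, true_and]
      apply le_antisymm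
      · rw [← (hmem m hm).2]
        exact hg (Fin.le_def.2 (by simp only; omega))
      · rw [← (hmem j hj).2]
        exact hg (Fin.le_def.2 (by simp only; omega))
    · rintro ⟨j, r⟩ hz ⟨j', r'⟩ hz' heq
      obtain ⟨hj, hr⟩ := Finset.mem_product.1 (Finset.mem_coe.1 hz)
      obtain ⟨hj', hr'⟩ := Finset.mem_product.1 (Finset.mem_coe.1 hz')
      have hr : r < s := Finset.mem_range.1 hr
      have hr' : r' < s := Finset.mem_range.1 hr'
      simp only at heq
      have hmod : (j : ℕ) ≡ j' [MOD s] :=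
        (hmem j (Finset.mem_of_mem_erase hj)).1.trans (hmem j' (Finset.mem_of_mem_erase hj')).1.symm
      have hrr : r = r' := Nat.ModEq.eq_of_lt_of_lt
        (Nat.ModEq.add_left_cancel hmod (by rw [heq])) hr hr'
      subst hrr
      exact Prod.ext (Fin.ext (by simp only; omega)) rfl
  rw [Finset.card_product, Finset.card_range, Finset.card_erase_of_mem hm,
    Finset.card_image_of_injective _ Fin.val_injective] at key
  have hpos : 1 ≤ A.card := Finset.card_pos.2 h
  obtain ⟨a, ha⟩ : ∃ a, A.card = a + 1 := ⟨A.card - 1, by omega⟩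
  rw [ha, Nat.add_sub_cancel] at key
  rw [ha]
  nlinarith

theorem card_filter_prod (p : Fin n × Fin n → Prop) [DecidablePred p] :
    (Finset.univ.filter p).card = ∑ i, (Finset.univ.filter fun j => p (i, j)).card := by
  simp only [Finset.card_filter, Fintype.sum_prod_type]

theorem card_dest_eq (x : IDTInput n M) (k : Fin n) :
    (Finset.univ.filter fun e => (payload x e).1 = k).card = n := by
  have hinj : Injective fun e : Fin n × Fin n => message x.1 e.1 e.2 := by
    intro e e' h
    exact Prod.ext (congrArg Message.source h) (congrArg Message.index h)
  refine Eq.trans ?_ (x.2 k)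
  rw [← Set.ncard_coe_finset, ← Set.ncard_image_of_injective _ hinj]
  congr 1
  ext m
  simp only [receiveSet, sourceSet, Set.mem_image, Set.mem_ofPred_eq, Set.mem_iUnion, Set.mem_range,
    Finset.coe_filter, Finset.mem_univ, true_and]
  constructor
  · rintro ⟨e, he, rfl⟩
    exact ⟨⟨e.1, e.2, rfl⟩, he⟩
  · rintro ⟨⟨i, j, rfl⟩, h⟩
    exact ⟨(i, j), h, rfl⟩

/-- A group has at most 3s nodes, each the destination of n messages. -/
theorem card_dest_mod_le (hs : 0 < s) (hns : n ≤ 3 * s * s) (x : IDTInput n M) (q : ℕ) :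
    (Finset.univ.filter fun e => ((payload x e).1 : ℕ) % s = q).card ≤ n * (3 * s) := by
  have h₁ : (Finset.univ.filter fun k : Fin n => (k : ℕ) % s = q).card ≤ 3 * s := by
    rw [← Finset.card_range (3 * s)]
    refine Finset.card_le_card_of_injOn (fun k => (k : ℕ) / s) ?_ ?_
    · intro k _
      simpa using (Nat.div_lt_iff_lt_mul hs).2 (lt_of_lt_of_le k.2 hns)
    · intro k hk k' hk' h
      have hk : (k : ℕ) % s = q := by simpa using hk
      have hk' : (k' : ℕ) % s = q := by simpa using hk'
      simp only at h
      apply Fin.ext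
      rw [← Nat.div_add_mod (k : ℕ) s, ← Nat.div_add_mod (k' : ℕ) s, hk, hk', h]
  refine le_trans (Finset.card_le_mul_card_image_of_maps_to (f := fun e => (payload x e).1)
    (t := Finset.univ.filter fun k : Fin n => (k : ℕ) % s = q) ?_ n ?_)
    (Nat.mul_le_mul_left n h₁)
  · intro e he
    simpa using he
  · intro k _
    refine le_trans (Finset.card_le_card ?_) (card_dest_eq x k).le
    exact Finset.filter_subset_filter _ (Finset.subset_univ _)

/-- The position of message `e` when its source sorts its messages by the group of the
destination. -/
noncomputable def sortedPosition (s : ℕ) (x : IDTInput n M) (e : Fin n × Fin n) : Fin n :=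
  (Tuple.sort fun j => ((payload x (e.1, j)).1 : ℕ) % s).symm e.2

theorem sortedPosition_injective (x : IDTInput n M) {e e' : Fin n × Fin n} (h : e.1 = e'.1)
    (h' : sortedPosition s x e = sortedPosition s x e') : e = e' := by
  obtain ⟨i, j⟩ := e
  obtain ⟨i', j'⟩ := e'
  simp only at h
  subst h
  rw [sortedPosition, sortedPosition] at h'
  exact Prod.ext rfl (Equiv.injective _ h')

theorem card_sortedPosition_le (x : IDTInput n M) (k : Fin n) :
    (Finset.univ.filter fun e => sortedPosition s x e = k).card ≤ n := by
  calc _ ≤ (Finset.univ : Finset (Fin n)).card := by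
        refine Finset.card_le_card_of_injOn Prod.fst (by simp) ?_
        intro e he e' he' h
        have he : sortedPosition s x e = k := by simpa using he
        have he' : sortedPosition s x e' = k := by simpa using he'
        exact sortedPosition_injective x h (he.trans he'.symm)
    _ = n := by simp

/-- Summing `mul_card_residue_le` over the sources bounds s times the count by 3sn + sn; the second
term is the rounding loss of one message per source. -/
theorem card_sortedPosition_mod_le (hs : 0 < s) (hns : n ≤ 3 * s * s) (x : IDTInput n M)
    (w q : ℕ) :
    (Finset.univ.filter fun e =>
      (sortedPosition s x e : ℕ) % s = w ∧ ((payload x e).1 : ℕ) % s = q).card ≤ 4 * n := by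
  have hrow : ∀ i : Fin n,
      s * (Finset.univ.filter fun j : Fin n => (sortedPosition s x (i, j) : ℕ) % s = w ∧
        ((payload x (i, j)).1 : ℕ) % s = q).card ≤
      (Finset.univ.filter fun j : Fin n => ((payload x (i, j)).1 : ℕ) % s = q).card + s := by
    intro i
    set f : Fin n → ℕ := fun j => ((payload x (i, j)).1 : ℕ) % s with hf
    have key := mul_card_residue_le (s := s) (f ∘ Tuple.sort f) (Tuple.monotone_sort f) w q
    have h₁ : (Finset.univ.filter fun j : Fin n => (sortedPosition s x (i, j) : ℕ) % s = w ∧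
        f j = q).card = (Finset.univ.filter fun j : Fin n => (j : ℕ) % s = w ∧
        (f ∘ Tuple.sort f) j = q).card := by
      refine Finset.card_equiv (Tuple.sort f).symm fun j => ?_
      simp [sortedPosition, hf]
    have h₂ : (Finset.univ.filter fun j : Fin n => f j = q).card =
        (Finset.univ.filter fun j : Fin n => (f ∘ Tuple.sort f) j = q).card := by
      refine Finset.card_equiv (Tuple.sort f).symm fun j => ?_
      simp
    rw [← h₁, ← h₂] at key
    exact key
  have hsum := Finset.sum_le_sum fun i (_ : i ∈ Finset.univ) => hrow i
  rw [← Finset.mul_sum, Finset.sum_add_distrib, ← card_filter_prod fun e =>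
      (sortedPosition s x e : ℕ) % s = w ∧ ((payload x e).1 : ℕ) % s = q,
    ← card_filter_prod fun e => ((payload x e).1 : ℕ) % s = q] at hsum
  have hd := card_dest_mod_le hs hns x q
  simp only [Finset.sum_const, Finset.card_univ, Fintype.card_fin, smul_eq_mul] at hsum
  refine Nat.le_of_mul_le_mul_left ?_ hs
  nlinarith

end Counting

/-! ### The nine-round routing scheme -/

section Routing

variable {n M B : ℕ}

theorem knows_held_source : Knows B 0 fun x : IDTInput n M => held x Prod.fst := by
  refine ⟨⟨fun _ _ _ _ => ⟨[], by simp⟩, fun k a _ => {z | z.1.1 = k ∧ a z.1.2 = z.2}⟩, ?_⟩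
  intro x k
  ext z
  simp only [Algorithm.result, held, payload, Set.mem_ofPred_eq]
  refine and_congr_right ?_
  rintro rfl
  rfl

theorem exists_group_count (hn : 0 < n) : ∃ s : ℕ, 0 < s ∧ s * s ≤ n ∧ n ≤ 3 * s * s := by
  refine ⟨Nat.sqrt n, Nat.sqrt_pos.2 hn, Nat.sqrt_le n, ?_⟩
  have h₁ := Nat.sqrt_le_add n
  have h₂ := Nat.sqrt_pos.2 hn
  nlinarith

theorem knows_held_dest (hn : 0 < n) (hB : Fits B (Fin 3 → Fin 3 → Fin (4 * n + 1)))
    (hB' : Fits B (Fin 8 → Option ((Fin n × Fin n) × (Fin n × BitString M)))) :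
    Knows B 9 fun x : IDTInput n M => held x fun e => (payload x e).1 := by
  obtain ⟨s, hs, hsn, hns⟩ := exists_group_count hn
  have h₁ : Knows B 1 fun x : IDTInput n M => held x (sortedPosition s x) := by
    refine knows_held_source.transfer hB' (fun _ => Prod.fst) (sortedPosition s)
      (fun _ _ _ h => h) ?_ ?_ _ ?_
    · rintro x y i h ⟨i', j⟩ rfl
      have : ∀ j, payload y (i', j) = payload x (i', j) :=
        fun j => (loc_eq_of_held_eq h (e := (i', j)) rfl).2
      simp only [sortedPosition, this]
    · intro x i k
      refine le_trans (Finset.card_le_one.2 ?_) (by norm_num)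
      intro e he e' he'
      have he := (Finset.mem_filter.1 he).2
      have he' := (Finset.mem_filter.1 he').2
      exact sortedPosition_injective x (he.1.trans he'.1.symm) (he.2.trans he'.2.symm)
    · intro x y k _ h
      rw [held_eq_iUnion_sent x Prod.fst, held_eq_iUnion_sent y Prod.fst]
      exact Set.iUnion_congr h
  have hlt : ∀ x : IDTInput n M, ∀ e,
      ((payload x e).1 : ℕ) % s + (sortedPosition s x e : ℕ) % s * s < n := by
    intro x e
    have h₁ := Nat.mod_lt ((payload x e).1 : ℕ) hs
    have h₂ := Nat.mod_lt (sortedPosition s x e : ℕ) hs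
    nlinarith
  have hmod : ∀ a b : ℕ, (a % s + b % s * s) % s = a % s := by
    intro a b
    rw [Nat.add_mul_mod_self_right, Nat.mod_mod]
  have hdiv : ∀ a b : ℕ, (a % s + b % s * s) / s = b % s := by
    intro a b
    rw [Nat.add_mul_div_right _ _ hs, Nat.div_eq_of_lt (Nat.mod_lt a hs), zero_add]
  -- Node q + w * s receives what group w holds for group q. It lies in group q and encodes both w
  -- and q, as `Knows.groupMove` requires.
  let loc : IDTInput n M → Fin n × Fin n → Fin n := fun x e =>
    ⟨((payload x e).1 : ℕ) % s + (sortedPosition s x e : ℕ) % s * s, hlt x e⟩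
  have hloc : ∀ x e, (loc x e : ℕ) % s = ((payload x e).1 : ℕ) % s ∧
      (loc x e : ℕ) / s = (sortedPosition s x e : ℕ) % s := fun x e => ⟨hmod _ _, hdiv _ _⟩
  have h₂ : Knows B 5 fun x => held x (loc x) := by
    refine h₁.groupMove hs hsn hns (fun d => (d : ℕ) % s)
      (fun d => by have := Nat.mod_lt (d : ℕ) hs; omega) hB hB' ?_ ?_ ?_ ?_
    · intro x i
      exact (card_sortedPosition_le x i).trans (by omega)
    · exact card_sortedPosition_mod_le hs hns
    · intro x y e h h'
      simp only [loc, h, h']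
    · intro x e e' h
      rw [← (hloc x e).1, ← (hloc x e').1, ← (hloc x e).2, ← (hloc x e').2, h]
      exact ⟨rfl, rfl⟩
  refine h₂.groupMove hs hsn hns (fun d => (d : ℕ) / s)
    (fun d => (Nat.div_lt_iff_lt_mul hs).2 (lt_of_lt_of_le d.2 hns)) hB hB' ?_ ?_ ?_ ?_
  · intro x i
    -- The load of a node after the first move is exactly one (group, class) count from before it.
    refine le_trans (Finset.card_le_card ?_)
      (card_sortedPosition_mod_le hs hns x ((i : ℕ) / s) ((i : ℕ) % s))
    intro e he
    obtain rfl := (Finset.mem_filter.1 he).2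
    exact Finset.mem_filter.2 ⟨Finset.mem_univ _, (hloc x e).2.symm, (hloc x e).1.symm⟩
  · intro x w q
    -- Group w and class q now single out one destination, namely w + q * s.
    by_cases h : w + q * s < n
    · refine le_trans (Finset.card_le_card ?_) ((card_dest_eq x ⟨w + q * s, h⟩).le.trans (by omega))
      intro e he
      obtain ⟨rfl, rfl⟩ := (Finset.mem_filter.1 he).2
      refine Finset.mem_filter.2 ⟨Finset.mem_univ _, Fin.ext ?_⟩
      simp only [(hloc x e).1]
      rw [mul_comm, Nat.mod_add_div]
    · rw [Finset.filter_false_of_mem, Finset.card_empty]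
      · exact Nat.zero_le _
      · rintro e - ⟨rfl, rfl⟩
        apply h
        rw [(hloc x e).1, mul_comm, Nat.mod_add_div]
        exact Fin.is_lt _
  · intro x y e _ h
    rw [h]
  · intro x e e' h
    rw [(hloc x e).1, (hloc x e').1, h]
    exact ⟨rfl, rfl⟩

theorem exists_solvesIDT (hn : 0 < n) (hB : Fits B (Fin 3 → Fin 3 → Fin (4 * n + 1)))
    (hB' : Fits B (Fin 8 → Option ((Fin n × Fin n) × (Fin n × BitString M)))) :
    ∃ A : Algorithm n B (LocalInput n M) (Set (Message n M)), SolvesIDT A 16 := by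
  have h : Knows B 16 fun x : IDTInput n M => receiveSet x.1 := by
    refine ((knows_held_dest hn hB hB').mono (by norm_num)).of_determined _ ?_
    have key : ∀ x y : IDTInput n M, ∀ k,
        held x (fun e => (payload x e).1) k = held y (fun e => (payload y e).1) k →
        receiveSet x.1 k ⊆ receiveSet y.1 k := by
      rintro x y k h m ⟨hm, hk⟩
      obtain ⟨i, j, rfl⟩ : ∃ i j, message x.1 i j = m := by simpa [sourceSet] using hm
      obtain ⟨h₁, h₂⟩ := loc_eq_of_held_eq h (e := (i, j)) hk
      have h₃ : message y.1 i j = message x.1 i j := by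
        change y.1 i j = x.1 i j at h₂
        simp only [message, h₂]
      refine ⟨?_, hk⟩
      rw [← h₃]
      exact Set.mem_iUnion.2 ⟨i, j, rfl⟩
    exact fun x y k h => (key x y k h).antisymm (key y x k h.symm)
  obtain ⟨A, hA⟩ := h
  exact ⟨A, fun x hx k => hA ⟨x, hx⟩ k⟩

/-- Here ⌈log₂ n⌉ = 0, so no bits may be sent; but a sole node already knows the entire input. -/
theorem exists_solvesIDT_of_le_one (hn : n ≤ 1) (R : ℕ) :
    ∃ A : Algorithm n B (LocalInput n M) (Set (Message n M)), SolvesIDT A R := by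
  refine ⟨⟨fun _ _ _ _ => ⟨[], by simp⟩, fun k a _ => receiveSet (fun _ => a) k⟩, ?_⟩
  intro x _ k
  have : Subsingleton (Fin n) := Fin.subsingleton_iff_le_one.2 hn
  simp only [Algorithm.result]
  congr 1
  funext i
  rw [Subsingleton.elim i k]

end Routing

/-! ### Message lengths in terms of ⌈log₂ n⌉ -/

section Bandwidth

variable {n M B c l : ℕ}

/-- Nine counts of at most 4l bits each. -/
theorem fits_counts (hl : 1 ≤ l) (hn : n ≤ 2 ^ l) (hB : 36 * l ≤ B) :
    Fits B (Fin 3 → Fin 3 → Fin (4 * n + 1)) := by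
  apply fits_of_card_le
  have h₁ : 4 * n + 1 ≤ 2 ^ (4 * l) := by
    calc 4 * n + 1 ≤ 2 ^ 3 * 2 ^ l := by have := Nat.one_le_two_pow (n := l); omega
      _ = 2 ^ (3 + l) := (pow_add _ _ _).symm
      _ ≤ 2 ^ (4 * l) := Nat.pow_le_pow_right (by norm_num) (by omega)
  calc Nat.card (Fin 3 → Fin 3 → Fin (4 * n + 1)) = (4 * n + 1) ^ 9 := by
        simp [Nat.card_eq_fintype_card, ← pow_mul]
    _ ≤ (2 ^ (4 * l)) ^ 9 := Nat.pow_le_pow_left h₁ 9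
    _ = 2 ^ (36 * l) := by rw [← pow_mul]; congr 1; ring
    _ ≤ 2 ^ B := Nat.pow_le_pow_right (by norm_num) hB

/-- Each of the 8 slots takes 3l bits for source, index and destination, 2cl for the content, and
one more, at most l, for the empty slot. -/
theorem fits_slots (hl : 1 ≤ l) (hn : n ≤ 2 ^ l) (hM : M ≤ c * l) (hB : 8 * (4 + 2 * c) * l ≤ B) :
    Fits B (Fin 8 → Option ((Fin n × Fin n) × (Fin n × BitString M))) := by
  apply fits_of_card_le
  have h₁ : n * n * (n * Nat.card (BitString M)) + 1 ≤ 2 ^ ((4 + 2 * c) * l) := by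
    calc n * n * (n * Nat.card (BitString M)) + 1
        ≤ 2 ^ l * 2 ^ l * (2 ^ l * 2 ^ (2 * M)) + 1 := by
          gcongr
          exact card_bitString_le M
      _ = 2 ^ (3 * l + 2 * M) + 1 := by
          rw [← pow_add, ← pow_add, ← pow_add]
          congr 2
          ring
      _ ≤ 2 ^ (3 * l + 2 * M + 1) := by
          rw [pow_succ]
          have := Nat.one_le_two_pow (n := 3 * l + 2 * M)
          omega
      _ ≤ 2 ^ ((4 + 2 * c) * l) := Nat.pow_le_pow_right (by norm_num) (by nlinarith)
  calc Nat.card (Fin 8 → Option ((Fin n × Fin n) × (Fin n × BitString M)))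
      = (n * n * (n * Nat.card (BitString M)) + 1) ^ 8 := by
        rw [Nat.card_fun, Finite.card_option, Nat.card_prod, Nat.card_prod, Nat.card_prod]
        simp
    _ ≤ (2 ^ ((4 + 2 * c) * l)) ^ 8 := Nat.pow_le_pow_left h₁ 8
    _ = 2 ^ (8 * (4 + 2 * c) * l) := by rw [← pow_mul]; congr 1; ring
    _ ≤ 2 ^ B := Nat.pow_le_pow_right (by norm_num) hB

end Bandwidth

end CongestedClique

theorem theorem3p6 :
    ∀ c : ℕ, ∃ C : ℕ, ∀ n M : ℕ, M ≤ c * Nat.clog 2 n →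
      ∃ B : ℕ, B ≤ C * Nat.clog 2 n ∧
        ∃ A : CongestedClique.Algorithm n B (CongestedClique.LocalInput n M)
            (Set (CongestedClique.Message n M)),
          CongestedClique.SolvesIDT A 16 := by
  intro c
  refine ⟨36 + 8 * (4 + 2 * c), fun n M hM => ⟨_, le_rfl, ?_⟩⟩
  rcases Nat.lt_or_ge 1 n with hn | hn
  · have hl : 1 ≤ Nat.clog 2 n := Nat.clog_pos (by norm_num) hn
    have hnl : n ≤ 2 ^ Nat.clog 2 n := Nat.le_pow_clog (by norm_num) n
    exact CongestedClique.exists_solvesIDT (by omega)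
      (CongestedClique.fits_counts hl hnl (Nat.mul_le_mul_right _ (by omega)))
      (CongestedClique.fits_slots hl hnl hM (Nat.mul_le_mul_right _ (by omega)))
  · exact CongestedClique.exists_solvesIDT_of_le_one hn 16
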